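/- Let $S$ be a finite geometric simplicial complex in $\mathbb{R}^3$, that is, a finite set of simplices (convex hulls of non-empty affinely independent finite sets of points) which contains every non-empty face of each of its simplices and in which any two simplices that meet do so in a common face. For $\varepsilon > 0$ let the $\varepsilon$-inflation of $S$ be $$\mathcal{S}_\varepsilon(S) = \bigcup_{s \in S} \bigl(s + \{x \in \mathbb{R}^3 : \|x\|_2 \le \varepsilon\}\bigr),$$ the union of the Minkowski sums of the simplices of $S$ with the closed Euclidean ball of radius $\varepsilon$ centred at the origin. Then there is $\hat\varepsilon > 0$ such that for every $\varepsilon$ with $0 < \varepsilon \le \hat\varepsilon$ the topological boundary $\partial \mathcal{S}_\varepsilon(S)$ in $\mathbb{R}^3$, with the subspace topology, is a manifold surface, i.e. a topological 2-manifold without boundary (Hausdorff, second countable, and every point has an open neighbourhood homeomorphic to an open subset of $\mathbb{R}^2$). No general position assumption on the simplices of $S$ is made. -/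

import Mathlib

open scoped Pointwise

/-- Euclidean three-space. -/
abbrev R3 : Type := EuclideanSpace ℝ (Fin 3)

/-- The `ε`-inflation of the simplex with vertex set `s`: the Minkowski sum of the simplex
and the closed Euclidean ball of radius `ε` centred at the origin. -/
def simplexInflation (s : Finset R3) (ε : ℝ) : Set R3 :=
  convexHull ℝ (s : Set R3) + Metric.closedBall (0 : R3) ε

/-- The `ε`-inflation of a simplicial complex: the union of the inflations of its simplices. -/
def inflation (S : Geometry.SimplicialComplex ℝ R3) (ε : ℝ) : Set R3 :=
  ⋃ s ∈ S.faces, simplexInflation s ε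

/-- A topological space is a manifold surface if it is a topological 2-manifold without boundary:
Hausdorff, second countable, and covered by open sets homeomorphic to open subsets of the plane. -/
structure IsManifoldSurface (M : Type*) [TopologicalSpace M] : Prop where
  t2 : T2Space M
  secondCountable : SecondCountableTopology M
  locallyPlanar : Nonempty (ChartedSpace (EuclideanSpace ℝ (Fin 2)) M)

/-! For small ε the inflation is the closed ε-thickening of the compact union K of the simplices, so
its boundary should be the level set {d = ε} of the distance d to K. K is only locally star-shaped,
but that suffices: near a point x₀ of K, the vector from a point z to x₀ makes an obtuse or right
angle with the vector from its nearest point to z, up to translation to that point, so moving z away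
from x₀ increases d. Compactness makes this uniform for all small ε. A level set of a continuous
function strictly increasing along a direction v is locally a graph over the plane orthogonal to v,
hence a surface. Simplices enter only as compact convex sets, so general position plays no role. -/

open Topology in
/-- A real function is strictly increasing in the direction `v` near `x`. -/
def StrictlyIncreasingNear {E : Type*} [TopologicalSpace E] [AddCommGroup E] [Module ℝ E]
    (f : E → ℝ) (v x : E) : Prop :=
  ∃ U ∈ 𝓝 x, ∀ y ∈ U, ∀ t : ℝ, 0 < t → y + t • v ∈ U → f y < f (y + t • v)

section StarShaped

open Set Filter Topology Metric

variable {E : Type*}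

/-- A finite union of closed convex sets is star-shaped near each of its points. -/
theorem exists_ball_segment_subset_biUnion [NormedAddCommGroup E] [NormedSpace ℝ E]
    {ι : Type*} {I : Set ι} (hI : I.Finite) {C : ι → Set E} (hc : ∀ i ∈ I, IsClosed (C i))
    (hconv : ∀ i ∈ I, Convex ℝ (C i)) (x₀ : E) :
    ∃ r > 0, ∀ p ∈ ⋃ i ∈ I, C i, dist p x₀ < r → segment ℝ x₀ p ⊆ ⋃ i ∈ I, C i := by
  -- Close to `x₀`, only those pieces that contain `x₀` are met.
  have h : ∀ᶠ p in 𝓝 x₀, ∀ i ∈ I, p ∈ C i → x₀ ∈ C i := by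
    refine (eventually_all_finite hI).2 fun i hi => ?_
    by_cases hx : x₀ ∈ C i
    · exact Eventually.of_forall fun _ _ => hx
    · filter_upwards [(hc i hi).isOpen_compl.mem_nhds hx] with p hp hp'
      exact absurd hp' hp
  obtain ⟨r, hr, hball⟩ := Metric.eventually_nhds_iff.1 h
  refine ⟨r, hr, fun p hp hd => ?_⟩
  obtain ⟨i, hi, hpi⟩ := mem_iUnion₂.1 hp
  exact ((hconv i hi).segment_subset (hball hd i hi hpi) hpi).trans
    (subset_biUnion_of_mem (u := C) hi)

variable [NormedAddCommGroup E] [InnerProductSpace ℝ E]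

/-- `p` is also nearest to `z` on the convex segment from `x₀` to `p`, so the obtuse angle criterion
applies there although `K` need not be convex. -/
theorem inner_sub_nearest_le_zero {K : Set E} {x₀ p z : E} (hseg : segment ℝ x₀ p ⊆ K)
    (hp : infDist z K = dist z p) : inner ℝ (z - p) (x₀ - p) ≤ 0 := by
  refine (norm_eq_iInf_iff_real_inner_le_zero (convex_segment x₀ p)
    (right_mem_segment ℝ x₀ p)).1 (le_antisymm ?_ ?_) x₀ (left_mem_segment ℝ x₀ p)
  · have : Nonempty (segment ℝ x₀ p) := ⟨⟨p, right_mem_segment ℝ x₀ p⟩⟩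
    refine le_ciInf fun w => ?_
    rw [← dist_eq_norm, ← dist_eq_norm, ← hp]
    exact infDist_le_dist_of_mem (hseg w.2)
  · exact ciInf_le (f := fun w : segment ℝ x₀ p => ‖z - w‖)
      ⟨0, by rintro _ ⟨w, rfl⟩; exact norm_nonneg _⟩ ⟨p, right_mem_segment ℝ x₀ p⟩

/-- Off a compact set that is star-shaped near `x₀`, the distance to the set increases
in the direction away from `x₀`. -/
theorem strictlyIncreasingNear_infDist {K : Set E} (hK : IsCompact K) {x₀ x : E} (hx₀ : x₀ ∈ K)
    {r : ℝ} (hr : ∀ p ∈ K, dist p x₀ < r → segment ℝ x₀ p ⊆ K) (hx : dist x x₀ < r / 2)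
    (hpos : 0 < infDist x K) :
    StrictlyIncreasingNear (fun z => infDist z K) (x - x₀) x := by
  set ρ := infDist x K / 4 with hρ
  have hρ0 : 0 < ρ := by positivity
  set v := x - x₀ with hv
  have hv0 : 0 < ‖v‖ := by
    rw [hv, ← dist_eq_norm]
    exact hpos.trans_le (infDist_le_dist_of_mem hx₀)
  set s := min ρ (ρ ^ 2 / ‖v‖) with hs
  have hs0 : 0 < s := lt_min hρ0 (by positivity)
  -- The second ball keeps the nearest point of `z` within `r` of `x₀`. The first gives `‖z - p‖ ≥
  -- 3ρ`, hence `⟪z - p, v⟫ ≥ 6ρ²`, which dominates `t‖v‖² ≤ 2ρ²` in the expansion of `‖y - p‖²`.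
  refine ⟨ball x s ∩ ball x₀ (r / 2),
    inter_mem (ball_mem_nhds _ hs0) (isOpen_ball.mem_nhds hx), ?_⟩
  rintro y ⟨hyx, -⟩ t ht ⟨hzx, hzx₀⟩
  set z := y + t • v with hz
  rw [mem_ball] at hyx hzx hzx₀
  obtain ⟨p, hpK, hp⟩ := hK.exists_infDist_eq_dist ⟨x₀, hx₀⟩ z
  have hpx₀ : dist p x₀ < r := by
    have h1 := infDist_le_dist_of_mem (x := z) hx₀
    have h2 := dist_triangle_left p x₀ z
    linarith
  have hinner := inner_sub_nearest_le_zero (hr p hpK hpx₀) hp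
  have hsρ : s ≤ ρ := min_le_left _ _
  have hsv : s * ‖v‖ ≤ ρ ^ 2 := (le_div_iff₀ hv0).1 (min_le_right _ _)
  have hdz : 3 * ρ ≤ ‖z - p‖ := by
    rw [← dist_eq_norm, ← hp]
    have := infDist_le_infDist_add_dist (s := K) (x := x) (y := z)
    rw [dist_comm] at this
    linarith
  have hzv : ‖z - p‖ ^ 2 - ‖z - p‖ * ρ ≤ inner ℝ (z - p) v := by
    have e : v = (z - p) - (x₀ - p) - (z - x) := by rw [hv]; abel
    have h1 : inner ℝ (z - p) (z - x) ≤ ‖z - p‖ * ρ :=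
      (real_inner_le_norm _ _).trans
        (mul_le_mul_of_nonneg_left (by rw [← dist_eq_norm]; linarith) (norm_nonneg _))
    rw [e, inner_sub_right, inner_sub_right, real_inner_self_eq_norm_sq]
    linarith
  have htv : t * ‖v‖ ≤ 2 * ρ ^ 2 / ‖v‖ := by
    have h1 : dist z y = t * ‖v‖ := by
      rw [hz, dist_eq_norm, add_sub_cancel_left, norm_smul, Real.norm_of_nonneg ht.le]
    have h2 := dist_triangle_right z y x
    rw [le_div_iff₀ hv0]
    nlinarith
  have htv2 : t * ‖v‖ ^ 2 ≤ 2 * ρ ^ 2 := by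
    rw [le_div_iff₀ hv0] at htv
    linarith
  have hy : ‖y - p‖ ^ 2 < ‖z - p‖ ^ 2 := by
    have e : y - p = (z - p) - t • v := by rw [hz]; abel
    rw [e, norm_sub_sq_real, inner_smul_right, norm_smul, Real.norm_of_nonneg ht.le]
    have h1 : 6 * ρ ^ 2 ≤ inner ℝ (z - p) v := by nlinarith
    have h2 : 0 < 2 * inner ℝ (z - p) v - t * ‖v‖ ^ 2 := by nlinarith
    nlinarith [mul_pos ht h2]
  calc infDist y K ≤ dist y p := infDist_le_dist_of_mem hpK
    _ = ‖y - p‖ := dist_eq_norm _ _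
    _ < ‖z - p‖ := lt_of_pow_lt_pow_left₀ 2 (norm_nonneg _) hy
    _ = infDist z K := by rw [hp, dist_eq_norm]

theorem exists_pos_forall_strictlyIncreasingNear_infDist {ι : Type*} {I : Set ι} (hI : I.Finite)
    {C : ι → Set E} (hc : ∀ i ∈ I, IsCompact (C i)) (hconv : ∀ i ∈ I, Convex ℝ (C i)) :
    ∃ δ > 0, ∀ x ∈ cthickening δ (⋃ i ∈ I, C i), 0 < infDist x (⋃ i ∈ I, C i) →
      ∃ v ≠ 0, StrictlyIncreasingNear (fun z => infDist z (⋃ i ∈ I, C i)) v x := by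
  choose r hr0 hr using
    exists_ball_segment_subset_biUnion hI (fun i hi => (hc i hi).isClosed) hconv
  have hK : IsCompact (⋃ i ∈ I, C i) := hI.isCompact_biUnion hc
  obtain ⟨δ, hδ, hsub⟩ := hK.exists_cthickening_subset_open
    (isOpen_biUnion fun x₀ (_ : x₀ ∈ ⋃ i ∈ I, C i) => isOpen_ball (x := x₀) (ε := r x₀ / 2))
    fun x hx => mem_biUnion hx (mem_ball_self (half_pos (hr0 x)))
  refine ⟨δ, hδ, fun x hx hpos => ?_⟩
  obtain ⟨x₀, hx₀, hxx₀⟩ := mem_iUnion₂.1 (hsub hx)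
  refine ⟨x - x₀, ?_, strictlyIncreasingNear_infDist hK hx₀ (hr x₀) hxx₀ hpos⟩
  rintro h
  rw [sub_eq_zero] at h
  rw [h, infDist_zero_of_mem hx₀] at hpos
  exact hpos.false

end StarShaped

section LevelSet

open Set Filter Topology Metric

/-- Near a point where a continuous function strictly increases in some direction, its level set
is a graph over the orthogonal complement of this direction. -/
theorem exists_chart_of_strictlyIncreasingNear {E : Type*} [NormedAddCommGroup E]
    [InnerProductSpace ℝ E] {n : ℕ} [Fact (Module.finrank ℝ E = n + 1)] {f : E → ℝ}
    (hf : Continuous f) {M : Set E} {c : ℝ} (hM : ∀ x, x ∈ M ↔ f x = c) (x : M) {v : E}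
    (hv : v ≠ 0) (hinc : StrictlyIncreasingNear f v x) :
    ∃ e : OpenPartialHomeomorph M (EuclideanSpace ℝ (Fin n)), x ∈ e.source := by
  obtain ⟨U', hU', hmono'⟩ := hinc
  obtain ⟨U, hUU', hU, hxU⟩ := _root_.mem_nhds_iff.1 hU'
  have hmono : ∀ y ∈ U, ∀ t : ℝ, 0 < t → y + t • v ∈ U → f y < f (y + t • v) :=
    fun y hy t ht h => hmono' y (hUU' hy) t ht (hUU' h)
  have : FiniteDimensional ℝ E := .of_fact_finrank_eq_succ n
  let b := OrthonormalBasis.fromOrthogonalSpanSingleton (𝕜 := ℝ) n hv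
  let V : Submodule ℝ E := (Submodule.span ℝ {v})ᗮ
  let L : E →L[ℝ] EuclideanSpace ℝ (Fin n) :=
    (b.repr.toContinuousLinearEquiv : V →L[ℝ] EuclideanSpace ℝ (Fin n)) ∘L V.orthogonalProjectionOnto
  let σ : EuclideanSpace ℝ (Fin n) →L[ℝ] E :=
    V.subtypeL ∘L (b.repr.symm.toContinuousLinearEquiv : EuclideanSpace ℝ (Fin n) →L[ℝ] V)
  have hLσ : ∀ w, L (σ w) = w := fun w => by
    simp [L, σ]
  have hLv : L v = 0 := by
    have : V.orthogonalProjectionOnto v = 0 :=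
      Submodule.orthogonalProjectionOnto_orthogonal_apply_eq_zero (Submodule.mem_span_singleton_self v)
    simp [L, this]
  have hker : ∀ y z, L y = L z → ∃ t : ℝ, z = y + t • v := by
    intro y z h
    have h0 : V.orthogonalProjectionOnto (z - y) = 0 := by
      have : V.orthogonalProjectionOnto y = V.orthogonalProjectionOnto z := b.repr.injective h
      rw [map_sub, this, sub_self]
    have h1 : z - y ∈ Vᗮ := Submodule.orthogonalProjectionOnto_eq_zero_iff.1 h0
    rw [Submodule.orthogonal_orthogonal] at h1
    obtain ⟨t, ht⟩ := Submodule.mem_span_singleton.1 h1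
    exact ⟨t, by rw [ht]; abel⟩
  let s : Set M := Subtype.val ⁻¹' U
  have hs : IsOpen s := hU.preimage continuous_subtype_val
  have hcont : Continuous fun y : M => L y := L.continuous.comp continuous_subtype_val
  -- Two level points with equal projection differ by a multiple of `v`, along which `f` is strictly
  -- monotone.
  have hinj : InjOn (fun y : M => L y) s := by
    intro y hy z hz h
    obtain ⟨t, ht⟩ := hker _ _ h
    have hfy := (hM y).1 y.2
    have hfz := (hM z).1 z.2
    rcases lt_trichotomy t 0 with h0 | h0 | h0
    · have e : (y : E) = z + (-t) • v := by rw [ht]; module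
      have := hmono z hz (-t) (by linarith) (e ▸ hy)
      rw [← e] at this
      linarith
    · exact Subtype.ext (by rw [ht, h0, zero_smul, add_zero])
    · have := hmono y hy t h0 (ht ▸ hz)
      rw [← ht] at this
      linarith
  have hopen : IsOpenMap (s.domRestrict fun y : M => L y) := by
    rw [isOpenMap_iff_nhds_le]
    rintro ⟨y, hy⟩ W hW
    rw [mem_map, nhds_subtype_eq_comap, nhds_subtype_eq_comap, comap_comap, mem_comap] at hW
    obtain ⟨B, hB, hBW⟩ := hW
    obtain ⟨η, hη, hηB⟩ := Metric.mem_nhds_iff.1 (inter_mem hB (hU.mem_nhds hy))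
    obtain ⟨t, ht0, htη⟩ : ∃ t : ℝ, 0 < t ∧ ‖t • v‖ < η := by
      refine ⟨η / 2 / ‖v‖, by positivity, ?_⟩
      rw [norm_smul, Real.norm_of_nonneg (by positivity),
        div_mul_cancel₀ _ (norm_ne_zero_iff.2 hv)]
      linarith
    -- `g τ q` is the point over `q` at height `τ` relative to `y`. Since `f < c` at height `-t` and
    -- `f > c` at height `t`, also for `q` near `L y`, the intermediate value theorem gives a level
    -- point over each such `q`.
    let g : ℝ → EuclideanSpace ℝ (Fin n) → E := fun τ q => y + σ (q - L y) + τ • v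
    have hg : ∀ τ, Continuous (g τ) := fun τ => by fun_prop
    have hg0 : ∀ τ, g τ (L y) = y + τ • v := fun τ => by simp [g]
    have hmem : ∀ τ : ℝ, ‖τ • v‖ < η → ∀ᶠ q in 𝓝 (L y), g τ q ∈ ball (y : E) η := fun τ hτ =>
      (hg τ).continuousAt.eventually_mem (isOpen_ball.mem_nhds (by simpa [hg0] using hτ))
    have htη' : ‖(-t) • v‖ < η := by rwa [neg_smul, norm_neg]
    have hfy := (hM y).1 y.2
    have hlo : f (g (-t) (L y)) < c := by
      have e : (y : E) = g (-t) (L y) + t • v := by rw [hg0]; module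
      have := hmono (g (-t) (L y)) (hηB (hmem _ htη').self_of_nhds).2 t ht0 (e ▸ hy)
      rwa [← e, hfy] at this
    have hhi : c < f (g t (L y)) := by
      have h := (hηB (hmem _ htη).self_of_nhds).2
      rw [hg0] at h ⊢
      exact hfy ▸ hmono y hy t ht0 h
    filter_upwards [hmem _ htη', hmem _ htη,
      (hf.comp (hg (-t))).continuousAt.eventually_lt_const hlo,
      (hf.comp (hg t)).continuousAt.eventually_const_lt hhi] with q h1 h2 h3 h4
    obtain ⟨τ, hτ, hτc⟩ := intermediate_value_Icc (by linarith : -t ≤ t)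
      (f := fun τ => f (g τ q)) (by fun_prop) ⟨h3.le, h4.le⟩
    have hτball : g τ q ∈ ball (y : E) η := by
      refine (convex_ball (y : E) η).segment_subset h1 h2 ?_
      rw [segment_eq_image']
      refine ⟨(τ + t) / (2 * t), ⟨div_nonneg (by linarith [hτ.1]) (by linarith),
        (div_le_one (by linarith)).2 (by linarith [hτ.2])⟩, ?_⟩
      have : τ = -t + (τ + t) / (2 * t) * (2 * t) := by field_simp; ring
      simp only [g]
      conv_rhs => rw [this]
      module
    have := @hBW ⟨⟨g τ q, (hM _).2 hτc⟩, (hηB hτball).2⟩ (hηB hτball).1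
    rw [mem_preimage] at this
    convert this
    simp [g, hLσ, hLv]
  have : Nonempty M := ⟨x⟩
  exact ⟨OpenPartialHomeomorph.ofContinuousOpenRestrict (hinj.toPartialEquiv _ _)
    hcont.continuousOn hopen hs, hxU⟩

/-- The points `x + t • v` with small `t > 0` leave the sublevel set. This rules out level points
interior to the thickening. -/
theorem StrictlyIncreasingNear.mem_frontier {E : Type*} [TopologicalSpace E] [AddCommGroup E]
    [Module ℝ E] [ContinuousAdd E] [ContinuousSMul ℝ E] {f : E → ℝ} {v x : E}
    (h : StrictlyIncreasingNear f v x) : x ∈ frontier {y | f y ≤ f x} := by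
  obtain ⟨U, hU, hmono⟩ := h
  refine ⟨subset_closure (le_refl (f x)), fun hint => ?_⟩
  have hlim : Tendsto (fun t : ℝ => x + t • v) (𝓝[>] 0) (𝓝 x) := by
    have : Continuous fun t : ℝ => x + t • v := by fun_prop
    simpa using (this.tendsto 0).mono_left nhdsWithin_le_nhds
  obtain ⟨t, ht0, ht⟩ := ((eventually_mem_nhdsWithin (a := (0 : ℝ)) (s := Ioi 0)).and
    (hlim.eventually (inter_mem (mem_interior_iff_mem_nhds.1 hint) hU))).exists
  exact absurd (hmono x (mem_of_mem_nhds hU) t ht0 ht.2) (not_lt.2 ht.1)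

end LevelSet

theorem inflation_eq_cthickening {S : Geometry.SimplicialComplex ℝ R3} (hS : S.faces.Finite)
    {ε : ℝ} (hε : 0 ≤ ε) :
    inflation S ε = Metric.cthickening ε (⋃ s ∈ S.faces, convexHull ℝ (s : Set R3)) := by
  have hK : IsCompact (⋃ s ∈ S.faces, convexHull ℝ (s : Set R3)) :=
    hS.isCompact_biUnion fun s _ => s.finite_toSet.isCompact_convexHull ℝ
  rw [← hK.add_closedBall_zero hε]
  simp only [inflation, simplexInflation, Set.iUnion_add]

theorem isManifoldSurface_of_charts {M : Set R3}
    (h : ∀ x : M, ∃ e : OpenPartialHomeomorph M (EuclideanSpace ℝ (Fin 2)), x ∈ e.source) :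
    IsManifoldSurface M := by
  choose e he using h
  exact ⟨inferInstance, inferInstance, ⟨{
    atlas := Set.range e
    chartAt := e
    mem_chart_source := he
    chart_mem_atlas := Set.mem_range_self }⟩⟩

theorem theorem1 (S : Geometry.SimplicialComplex ℝ R3) (hS : S.faces.Finite) :
    ∃ εhat : ℝ, 0 < εhat ∧
      ∀ ε : ℝ, 0 < ε → ε ≤ εhat → IsManifoldSurface (frontier (inflation S ε)) := by
  obtain ⟨δ, hδ, hreg⟩ := exists_pos_forall_strictlyIncreasingNear_infDist hS
    (C := fun s : Finset R3 => convexHull ℝ (s : Set R3))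
    (fun s _ => s.finite_toSet.isCompact_convexHull ℝ) (fun s _ => convex_convexHull ℝ _)
  refine ⟨δ, hδ, fun ε hε hεδ => ?_⟩
  rw [inflation_eq_cthickening hS hε.le]
  set K : Set R3 := ⋃ s ∈ S.faces, convexHull ℝ (s : Set R3) with hK
  -- For empty `K` the default `infDist x ∅ = 0` would break `hthick`; the frontier is then empty.
  rcases K.eq_empty_or_nonempty with h0 | hne
  · refine isManifoldSurface_of_charts fun x => ?_
    have := x.2
    simp [h0] at this
  have hthick : Metric.cthickening ε K = {x | Metric.infDist x K ≤ ε} := by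
    ext x
    rw [Metric.mem_cthickening_iff, Set.mem_ofPred_eq, Metric.infDist,
      ENNReal.le_ofReal_iff_toReal_le (Metric.infEDist_ne_top hne) hε.le]
  have hreg' : ∀ x, Metric.infDist x K = ε →
      ∃ v ≠ 0, StrictlyIncreasingNear (fun z => Metric.infDist z K) v x := fun x hx =>
    hreg x (Metric.cthickening_mono hεδ K (hthick ▸ hx.le)) (hx ▸ hε)
  have hfr : ∀ x, x ∈ frontier (Metric.cthickening ε K) ↔ Metric.infDist x K = ε := by
    intro x
    rw [hthick]
    refine ⟨fun hx => frontier_le_subset_eq (Metric.continuous_infDist_pt K)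
      continuous_const hx, fun hx => ?_⟩
    obtain ⟨v, -, hv⟩ := hreg' x hx
    simpa only [hx] using hv.mem_frontier
  refine isManifoldSurface_of_charts fun x => ?_
  obtain ⟨v, hv0, hv⟩ := hreg' x ((hfr x).1 x.2)
  have : Fact (Module.finrank ℝ R3 = 2 + 1) := ⟨by simp⟩
  exact exists_chart_of_strictlyIncreasingNear (Metric.continuous_infDist_pt K) hfr x hv0 hv
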